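/- Let $n\ge 2$ be an integer with $n\equiv\pm1\pmod 6$, let $k\ge1$, and put $w=\max\{\nu_3(n-1),\nu_3(n+1)\}$, where $\nu_3$ is the $3$-adic valuation. Let $T_n$ be the Chebyshev polynomial defined by $T_0(x)=1$, $T_1(x)=x$, $T_m(x)=2xT_{m-1}(x)-T_{m-2}(x)$, and let $\mathcal G_{3^k}$ be the functional graph of $T_n$ over $\mathbb Z_{3^k}=\mathbb Z/3^k\mathbb Z$, i.e. the directed graph with vertex set $\mathbb Z_{3^k}$ and an edge $x\to T_n(x)$ for every $x\in\mathbb Z_{3^k}$. The (weakly) connected components of $\mathcal G_{3^k}$ that contain a vertex $x\equiv\pm1\pmod3$ consist only of vertices $x\equiv\pm1\pmod 3$, and they are the following. - If $k\ge w+2$, they are exactly: $8\cdot3^{w-1}$ directed cycles of length $3^i$ for each $i\in\{1,2,\dots,k-w-2\}$ (none of this kind if $k=w+2$), $4\cdot3^w$ self-loops, and $2\cdot3^{w-1}$ directed cycles of length $3^{k-w-1}$. - If $k<w+2$, they are exactly $2\cdot3^{k-1}$ self-loops. -/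

import Mathlib

/-- The functional graph of a self-map `f`: its vertices are the states `x : V`, and it has
exactly one directed edge `x → f x` out of each state (a self-loop when `f x = x`). -/
def functionalGraph {V : Type*} (f : V → V) : Digraph V where
  Adj x y := f x = y

/-- The (weakly) connected components of a directed graph. -/
abbrev DiComponent {V : Type*} (G : Digraph V) : Type _ :=
  G.toSimpleGraphInclusive.ConnectedComponent

/-- The component `C` of the directed graph `G` is a directed cycle with exactly `L ≥ 1` vertices:
its vertices can be labelled bijectively by `ℤ/Lℤ` in such a way that the edges of `G` among them
are exactly the edges `a → a + 1`. For `L = 1` this is a single vertex with a self-loop. -/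
def IsDirectedCycle {V : Type*} (G : Digraph V) (C : DiComponent G) (L : ℕ) : Prop :=
  1 ≤ L ∧ ∃ c : ZMod L → V, Function.Injective c ∧ Set.range c = C.supp ∧
    ∀ a b : ZMod L, G.Adj (c a) (c b) ↔ b = a + 1

/-- The functional graph of the Chebyshev polynomial `T_n` over `ℤ/3^kℤ`. -/
noncomputable def chebyshevGraph (n k : ℕ) : Digraph (ZMod (3 ^ k)) :=
  functionalGraph fun x => (Polynomial.Chebyshev.T (ZMod (3 ^ k)) (n : ℤ)).eval x

/-- The number `w = max {ν₃(n - 1), ν₃(n + 1)}`. -/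
def chebyshevW (n : ℕ) : ℕ :=
  max (padicValNat 3 (n - 1)) (padicValNat 3 (n + 1))

/-- The states `x ∈ ℤ/3^kℤ` with `x ≡ ±1 (mod 3)`. -/
def pmOneStates (k : ℕ) : Set (ZMod (3 ^ k)) :=
  {x | (x.val : ℤ) ≡ 1 [ZMOD 3] ∨ (x.val : ℤ) ≡ -1 [ZMOD 3]}

/-- The connected components of the graph of `T_n` over `ℤ/3^kℤ` that contain a state
`x ≡ ±1 (mod 3)`. -/
def pmOneComponents (n k : ℕ) : Set (DiComponent (chebyshevGraph n k)) :=
  {C | ∃ x ∈ pmOneStates k, x ∈ C.supp}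

/-- Those among these components that are directed cycles of length `L`. -/
def pmOneCycles (n k L : ℕ) : Set (DiComponent (chebyshevGraph n k)) :=
  {C | C ∈ pmOneComponents n k ∧ IsDirectedCycle (chebyshevGraph n k) C L}

/-! The i-th iterate of T_n is T_N with N = n^i, so cycle lengths are governed by the fixed states
of T_N for N = n^(3^j). For odd N = 2b+1 one has T_N(x) - x = 2(x^2-1) U_b(x) U_{b-1}(x), while
N^2-1 = 4b(b+1). At x = 1+3y this yields T_N(x) - x = 3^(v+1) y(1+2y) d with d prime to 3 and v =
ν₃(N^2-1) (`exists_eval_T_sub_eq`); lifting the exponent gives v = w+j. Since y and 1+2y are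
coprime, the fixed states come from two residue classes of y, doubled by x ↦ -x, until k ≤ v+1, when
every state ±1 mod 3 is fixed (`ncard_periodic_eq`).

Hence these states all have 3-power periods and their components are cycles. Differences of
successive counts, divided by the length, count the cycles (`ncard_directedCycles_mul`). -/

/-! ### Chebyshev identities and 3-adic valuations -/

open Polynomial Polynomial.Chebyshev in
theorem Polynomial.Chebyshev.U_sq_add_U_sq (R : Type*) [CommRing R] (n : ℤ) :
    U R n ^ 2 + U R (n + 1) ^ 2 - 2 * X * U R n * U R (n + 1) = 1 := by
  have h := congrArg (fun p => p.comp (2 * X)) (S_sq_add_S_sq R n)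
  simpa [S_comp_two_mul_X] using h

open Polynomial Polynomial.Chebyshev in
theorem Polynomial.Chebyshev.T_two_mul_add_one_sub_X (R : Type*) [CommRing R] (b : ℤ) :
    T R (2 * b + 1) - X = 2 * (X ^ 2 - 1) * U R b * U R (b - 1) := by
  have h1 := T_mul_T R (b + 1) b
  have h2 := T_eq_X_mul_T_sub_pol_U R (b - 1)
  have h3 := T_eq_U_sub_X_mul_U R b
  have h4 := U_sq_add_U_sq R (b - 1)
  rw [show b + 1 + b = 2 * b + 1 by ring, show b + 1 - b = 1 by ring, T_one] at h1
  rw [show b - 1 + 2 = b + 1 by ring, show b - 1 + 1 = b by ring] at h2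
  rw [show b - 1 + 1 = b by ring] at h4
  rw [h2, h3] at h1
  linear_combination (-1 : R[X]) * h1 + 2 * X * h4

-- Differentiate T_{mn} = T_m ∘ T_n and cancel the factor m.
open Polynomial Polynomial.Chebyshev in
theorem Polynomial.Chebyshev.U_mul_sub_one {m n : ℤ} (hm : m ≠ 0) :
    U ℤ (m * n - 1) * (n : ℤ[X]) = (U ℤ (m - 1)).comp (T ℤ n) * ((n : ℤ[X]) * U ℤ (n - 1)) := by
  have h := congrArg derivative (T_mul ℤ m n)
  rw [derivative_comp, T_derivative_eq_U, T_derivative_eq_U, T_derivative_eq_U] at h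
  simp only [mul_comp, intCast_comp] at h
  have hm' : (m : ℤ[X]) ≠ 0 := by exact_mod_cast hm
  apply mul_left_cancel₀ hm'
  push_cast at h
  linear_combination h

open Polynomial Polynomial.Chebyshev in
theorem Polynomial.Chebyshev.eval_U_three_mul_sub_one {m : ℤ} (hm : m ≠ 0) (x : ℤ) :
    (U ℤ (m * 3 - 1)).eval x = (4 * x ^ 2 - 1) * (U ℤ (m - 1)).eval (4 * x ^ 3 - 3 * x) := by
  have h := congrArg (eval x) (U_mul_sub_one (n := 3) hm)
  have h3 : T ℤ 3 = 4 * X ^ 3 - 3 * X := by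
    have := T_add_two ℤ 1
    norm_num at this
    rw [this, T_two]; ring
  have h2 : U ℤ (3 - 1) = 4 * X ^ 2 - 1 := U_two ℤ
  rw [h3, h2] at h
  simp only [eval_mul, eval_comp, eval_sub, eval_pow, eval_X, eval_one, eval_ofNat, Int.cast_ofNat]
    at h
  linarith

-- Modulo 3 the value is U_{m-1}(1) = m.
open Polynomial Polynomial.Chebyshev in
theorem not_three_dvd_eval_U {m : ℤ} (hm : ¬ 3 ∣ m) (y : ℤ) :
    ¬ 3 ∣ (U ℤ (m - 1)).eval (1 + 3 * y) := by
  intro h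
  have h1 := sub_dvd_eval_sub (1 + 3 * y) 1 (U ℤ (m - 1))
  rw [U_eval_one] at h1
  have h2 : (3 : ℤ) ∣ 1 + 3 * y - 1 := ⟨y, by ring⟩
  have h3 := (dvd_sub_right h).1 (h2.trans h1)
  push_cast at h3
  simp at h3
  exact hm h3

theorem not_three_dvd_mul {a b : ℤ} (ha : ¬ 3 ∣ a) (hb : ¬ 3 ∣ b) : ¬ 3 ∣ a * b :=
  fun h => (Int.prime_three.dvd_or_dvd h).elim ha hb

open Polynomial Polynomial.Chebyshev in
/-- The exact power of `3` dividing `U_{3^s m - 1}(1 + 3 y)`, apart from that of `1 + 2 y`. -/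
theorem exists_eval_U_eq {m : ℤ} (hm : ¬ 3 ∣ m) (s : ℕ) (y : ℤ) :
    ∃ c : ℤ, ¬ 3 ∣ c ∧
      (U ℤ (3 ^ (s + 1) * m - 1)).eval (1 + 3 * y) = 3 ^ (s + 1) * (1 + 2 * y) * c := by
  have hm0 : m ≠ 0 := by rintro rfl; simp at hm
  -- Each factor 3 of the index contributes 4x^2-1 = 3(1+2y)(1+6y) and replaces y by y' =
  -- 9y(1+2y)^2, because T_3(1+3y) = 1+3y'. Since 1+2y' is prime to 3, the factor 1+2y does not
  -- accumulate.
  induction s generalizing y with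
  | zero =>
    refine ⟨(1 + 6 * y) * (U ℤ (m - 1)).eval (1 + 3 * (9 * y * (1 + 2 * y) ^ 2)), ?_, ?_⟩
    · exact not_three_dvd_mul (by omega) (not_three_dvd_eval_U hm _)
    · rw [zero_add, pow_one, mul_comm 3 m, eval_U_three_mul_sub_one hm0]
      rw [show 4 * (1 + 3 * y) ^ 3 - 3 * (1 + 3 * y) = 1 + 3 * (9 * y * (1 + 2 * y) ^ 2) by
        ring]
      ring
  | succ s ih =>
    obtain ⟨c, hc, h⟩ := ih (9 * y * (1 + 2 * y) ^ 2)
    refine ⟨(1 + 6 * y) * ((1 + 2 * (9 * y * (1 + 2 * y) ^ 2)) * c), ?_, ?_⟩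
    · refine not_three_dvd_mul (by omega) (not_three_dvd_mul ?_ hc)
      rw [show 1 + 2 * (9 * y * (1 + 2 * y) ^ 2) = 1 + 3 * (6 * y * (1 + 2 * y) ^ 2) by ring]
      omega
    · rw [show (3 : ℤ) ^ (s + 1 + 1) * m - 1 = 3 ^ (s + 1) * m * 3 - 1 by ring,
        eval_U_three_mul_sub_one (by positivity)]
      rw [show 4 * (1 + 3 * y) ^ 3 - 3 * (1 + 3 * y) = 1 + 3 * (9 * y * (1 + 2 * y) ^ 2) by ring, h]
      ring

open Polynomial Polynomial.Chebyshev in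
/-- The exact power of `3` dividing `T_N(x) - x` for odd `N` and `x = 1 + 3 y`. -/
theorem exists_eval_T_sub_eq {N c : ℤ} {s : ℕ} (hN : Odd N) (hs : N ^ 2 - 1 = 3 ^ (s + 1) * c)
    (hc : ¬ 3 ∣ c) (y : ℤ) :
    ∃ d : ℤ, ¬ 3 ∣ d ∧
      (T ℤ N).eval (1 + 3 * y) - (1 + 3 * y) = 3 ^ (s + 2) * (y * (1 + 2 * y)) * d := by
  obtain ⟨b, rfl⟩ := hN
  have hT : (T ℤ (2 * b + 1)).eval (1 + 3 * y) - (1 + 3 * y)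
      = 6 * y * (2 + 3 * y) *
        ((U ℤ (b + 1 - 1)).eval (1 + 3 * y) * (U ℤ (b - 1)).eval (1 + 3 * y)) := by
    have h := congrArg (eval (1 + 3 * y)) (T_two_mul_add_one_sub_X ℤ b)
    simp only [eval_mul, eval_sub, eval_pow, eval_X, eval_one, eval_ofNat] at h
    rw [h, add_sub_cancel_right]
    ring
  have hab : 3 ^ (s + 1) * c = 4 * (b * (b + 1)) := by rw [← hs]; ring
  have hfac : ∀ {u v : ℤ}, 3 ^ (s + 1) * c = 4 * (u * v) → ¬ 3 ∣ v →
      ∃ m, ¬ 3 ∣ m ∧ u = 3 ^ (s + 1) * m := by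
    intro u v huv hv
    have hcop : IsCoprime ((3 : ℤ) ^ (s + 1)) (4 * v) :=
      IsCoprime.pow_left ((Prime.coprime_iff_not_dvd Int.prime_three).2
        (not_three_dvd_mul (by decide) hv))
    obtain ⟨m, rfl⟩ : (3 : ℤ) ^ (s + 1) ∣ u :=
      hcop.dvd_of_dvd_mul_right ⟨c, by rw [huv]; ring⟩
    refine ⟨m, ?_, rfl⟩
    rintro ⟨m', rfl⟩
    apply hc
    have h3 : (3 : ℤ) ^ (s + 1) ≠ 0 := by positivity
    refine ⟨4 * (m' * v), mul_left_cancel₀ h3 ?_⟩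
    rw [huv]; ring
  -- Only one of b, b+1 is divisible by 3 and it absorbs all of 3^(s+1). The U-factor attached to it
  -- carries that power; the other is prime to 3.
  by_cases hb : (3 : ℤ) ∣ b
  · have hb1 : ¬ (3 : ℤ) ∣ b + 1 := by omega
    obtain ⟨m, hm, rfl⟩ := hfac hab hb1
    obtain ⟨d, hd, h⟩ := exists_eval_U_eq hm s y
    refine ⟨2 * (2 + 3 * y) * ((U ℤ (3 ^ (s + 1) * m + 1 - 1)).eval (1 + 3 * y) * d), ?_, ?_⟩
    · exact not_three_dvd_mul (by omega) (not_three_dvd_mul (not_three_dvd_eval_U hb1 y) hd)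
    · rw [hT, h]; ring
  · obtain ⟨m, hm, hm'⟩ := hfac (u := b + 1) (v := b) (by rw [hab]; ring) hb
    obtain ⟨d, hd, h⟩ := exists_eval_U_eq hm s y
    refine ⟨2 * (2 + 3 * y) * ((U ℤ (b - 1)).eval (1 + 3 * y) * d), ?_, ?_⟩
    · exact not_three_dvd_mul (by omega) (not_three_dvd_mul (not_three_dvd_eval_U hb y) hd)
    · rw [hT, hm', h]; ring

/-- Lifting the exponent: cubing 1 + 3^a d with a ≥ 1 raises the valuation of the difference from 1
by exactly one. -/
theorem exists_pow_three_pow_sub_one_eq {q c : ℤ} {s : ℕ} (hq : q - 1 = 3 ^ (s + 1) * c)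
    (hc : ¬ 3 ∣ c) (j : ℕ) :
    ∃ d : ℤ, ¬ 3 ∣ d ∧ q ^ 3 ^ j - 1 = 3 ^ (s + j + 1) * d := by
  induction j with
  | zero => exact ⟨c, hc, by simpa using hq⟩
  | succ j ih =>
    obtain ⟨d, hd, h⟩ := ih
    set Q := q ^ 3 ^ j
    refine ⟨d * (1 + 3 * (3 ^ (s + j) * d + 3 ^ (2 * (s + j)) * d ^ 2)), ?_, ?_⟩
    · exact not_three_dvd_mul hd (by omega)
    · have hQ : Q = 1 + 3 ^ (s + j + 1) * d := by linarith
      rw [pow_succ, pow_mul, show q ^ 3 ^ j = Q from rfl, hQ]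
      ring

/-- One of n-1, n+1 is prime to 3, so the maximum of the two valuations is their sum. -/
theorem exists_sq_sub_one_eq {n : ℕ} (hn : 2 ≤ n) (hn6 : n % 6 = 1 ∨ n % 6 = 5) :
    1 ≤ chebyshevW n ∧ ∃ c : ℤ, ¬ 3 ∣ c ∧ (n : ℤ) ^ 2 - 1 = 3 ^ chebyshevW n * c := by
  have : Fact (Nat.Prime 3) := ⟨Nat.prime_three⟩
  have key : chebyshevW n = padicValNat 3 ((n - 1) * (n + 1)) := by
    rw [padicValNat.mul (by omega) (by omega), chebyshevW]
    rcases hn6 with h | h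
    · rw [padicValNat.eq_zero_of_not_dvd (n := n + 1) (by omega)]; simp
    · rw [padicValNat.eq_zero_of_not_dvd (n := n - 1) (by omega)]; simp
  have h0 : (n - 1) * (n + 1) ≠ 0 := Nat.mul_ne_zero (by omega) (by omega)
  have hz : (((n - 1) * (n + 1) : ℕ) : ℤ) = (n : ℤ) ^ 2 - 1 := by
    push_cast [Nat.cast_sub (show 1 ≤ n by omega)]; ring
  rw [key]
  constructor
  · refine one_le_padicValNat_of_dvd h0 ?_
    rcases hn6 with h | h
    · exact Dvd.dvd.mul_right (by omega) _
    · exact Dvd.dvd.mul_left (by omega) _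
  · obtain ⟨c, hc⟩ := pow_padicValNat_dvd (p := 3) (n := (n - 1) * (n + 1))
    refine ⟨c, ?_, ?_⟩
    · intro h3
      obtain ⟨e, rfl⟩ : 3 ∣ c := by exact_mod_cast h3
      apply pow_succ_padicValNat_not_dvd (p := 3) h0
      exact ⟨e, by rw [pow_succ, mul_assoc]; exact hc⟩
    · rw [← hz]; exact_mod_cast hc

/-! ### Components of functional graphs on periodic points -/

theorem functionalGraph_adj_inclusive {V : Type*} {f : V → V} {x y : V} :
    (functionalGraph f).toSimpleGraphInclusive.Adj x y ↔ x ≠ y ∧ (f x = y ∨ f y = x) :=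
  Iff.rfl

theorem functionalGraph_reachable_iterate {V : Type*} (f : V → V) (x : V) (i : ℕ) :
    (functionalGraph f).toSimpleGraphInclusive.Reachable x (f^[i] x) := by
  induction i with
  | zero => exact SimpleGraph.Reachable.refl _
  | succ i ih =>
    rw [Function.iterate_succ_apply']
    by_cases h : f^[i] x = f (f^[i] x)
    · rwa [← h]
    · exact ih.trans (SimpleGraph.Adj.reachable ⟨h, Or.inl rfl⟩)

theorem functionalGraph_mem_of_reachable {V : Type*} {f : V → V} {S : Set V}
    (hS : ∀ x, f x ∈ S ↔ x ∈ S) {x y : V} (hx : x ∈ S)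
    (h : (functionalGraph f).toSimpleGraphInclusive.Reachable x y) : y ∈ S := by
  rw [SimpleGraph.reachable_iff_reflTransGen] at h
  induction h with
  | refl => exact hx
  | tail _ hadj ih =>
    rcases functionalGraph_adj_inclusive.1 hadj with ⟨-, h | h⟩
    · rw [← h]; exact (hS _).2 ih
    · rw [← h] at ih; exact (hS _).1 ih

open Function in
theorem functionalGraph_reachable_iff {V : Type*} {f : V → V} {S : Set V}
    (hS : ∀ x, f x ∈ S ↔ x ∈ S) (hper : ∀ x ∈ S, x ∈ periodicPts f) {x y : V} (hx : x ∈ S) :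
    (functionalGraph f).toSimpleGraphInclusive.Reachable x y ↔ ∃ i, f^[i] x = y := by
  refine ⟨fun h => ?_, fun ⟨i, hi⟩ => hi ▸ functionalGraph_reachable_iterate f x i⟩
  rw [SimpleGraph.reachable_iff_reflTransGen] at h
  induction h with
  | refl => exact ⟨0, rfl⟩
  | @tail y z hy hadj ih =>
    obtain ⟨i, hi⟩ := ih
    rcases functionalGraph_adj_inclusive.1 hadj with ⟨-, h | h⟩
    · exact ⟨i + 1, by rw [iterate_succ_apply', hi, h]⟩
    · have hyS : y ∈ S := functionalGraph_mem_of_reachable hS hx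
        ((SimpleGraph.reachable_iff_reflTransGen _ _).2 hy)
      obtain ⟨p, hp, hz⟩ := hper z ((hS z).1 (h ▸ hyS))
      -- An edge z → y walked backwards equals p - 1 forward steps around the cycle of z.
      refine ⟨p - 1 + i, ?_⟩
      rw [iterate_add_apply, hi, ← h, ← iterate_succ_apply, Nat.succ_eq_add_one,
        Nat.sub_add_cancel hp]
      exact hz

open Function in
theorem iterate_of_forall_apply {V : Type*} {f : V → V} {L : ℕ} {c : ZMod L → V}
    (hc : ∀ a, f (c a) = c (a + 1)) (a : ZMod L) (i : ℕ) : f^[i] (c a) = c (a + i) := by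
  induction i with
  | zero => simp
  | succ i ih => rw [iterate_succ_apply', ih, hc]; push_cast; rw [add_assoc]

open Function in
theorem isDirectedCycle_iff_minimalPeriod_eq {V : Type*} {f : V → V} {S : Set V}
    (hS : ∀ x, f x ∈ S ↔ x ∈ S) (hper : ∀ x ∈ S, x ∈ periodicPts f) {x : V} (hx : x ∈ S) {L : ℕ} :
    IsDirectedCycle (functionalGraph f)
      ((functionalGraph f).toSimpleGraphInclusive.connectedComponentMk x) L ↔
      minimalPeriod f x = L := by
  constructor
  · rintro ⟨hL, c, hinj, hrange, hadj⟩
    have hc : ∀ a, f (c a) = c (a + 1) := fun a => (hadj a (a + 1)).2 rfl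
    obtain ⟨a, ha⟩ : x ∈ Set.range c := by
      rw [hrange]; exact SimpleGraph.ConnectedComponent.connectedComponentMk_mem
    have hiff : ∀ i, f^[i] x = x ↔ L ∣ i := by
      intro i
      rw [← ha, iterate_of_forall_apply hc, hinj.eq_iff, add_eq_left, ZMod.natCast_eq_zero_iff]
    apply Nat.dvd_antisymm
    · exact IsPeriodicPt.minimalPeriod_dvd ((hiff L).2 dvd_rfl)
    · exact (hiff _).1 iterate_minimalPeriod
  · rintro rfl
    have hpos := minimalPeriod_pos_of_mem_periodicPts (hper x hx)
    set L := minimalPeriod f x with hLdef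
    have : NeZero L := ⟨hpos.ne'⟩
    have hinj : Function.Injective fun a : ZMod L => f^[a.val] x := fun a b hab =>
      ZMod.val_injective L
        ((iterate_eq_iterate_iff_of_lt_minimalPeriod a.val_lt b.val_lt).1 hab)
    have hsucc : ∀ a : ZMod L, f (f^[a.val] x) = f^[(a + 1).val] x := by
      intro a
      rw [← iterate_succ_apply' f, ← iterate_mod_minimalPeriod_eq, ← hLdef]
      congr 2
      rw [ZMod.val_add, Nat.succ_eq_add_one, Nat.add_mod a.val 1, Nat.add_mod a.val (ZMod.val 1),
        ZMod.val_one_eq_one_mod, Nat.mod_mod]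
    refine ⟨hpos, fun a => f^[a.val] x, hinj, ?_, fun a b => ?_⟩
    · ext y
      rw [SimpleGraph.ConnectedComponent.mem_supp_iff, SimpleGraph.ConnectedComponent.eq]
      constructor
      · rintro ⟨a, rfl⟩
        exact (functionalGraph_reachable_iterate f x _).symm
      · intro h
        obtain ⟨i, rfl⟩ := (functionalGraph_reachable_iff hS hper hx).1 h.symm
        refine ⟨(i : ZMod L), ?_⟩
        dsimp only
        rw [ZMod.val_natCast, iterate_mod_minimalPeriod_eq]
    · change f (f^[a.val] x) = f^[b.val] x ↔ _
      rw [hsucc]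
      exact (hinj.eq_iff (a := a + 1) (b := b)).trans eq_comm

-- Double counting: the points of minimal period L in S are fibred over the cycles, each fibre being
-- the L-point support of its component.
open Function in
theorem ncard_directedCycles_mul {V : Type*} [Finite V] {f : V → V} {S : Set V}
    (hS : ∀ x, f x ∈ S ↔ x ∈ S) (hper : ∀ x ∈ S, x ∈ periodicPts f) (L : ℕ) :
    {C : DiComponent (functionalGraph f) | (∃ x ∈ S, x ∈ C.supp) ∧
      IsDirectedCycle (functionalGraph f) C L}.ncard * L =
    {x | x ∈ S ∧ minimalPeriod f x = L}.ncard := by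
  classical
  have := Fintype.ofFinite V
  have : Fintype (DiComponent (functionalGraph f)) := Fintype.ofFinite _
  rw [Set.ncard_eq_toFinset_card', Set.ncard_eq_toFinset_card' {x | x ∈ S ∧ minimalPeriod f x = L},
    Finset.card_eq_sum_card_fiberwise (s := {x | x ∈ S ∧ minimalPeriod f x = L}.toFinset)
      (f := (functionalGraph f).toSimpleGraphInclusive.connectedComponentMk)
      (t := {C : DiComponent (functionalGraph f) | (∃ x ∈ S, x ∈ C.supp) ∧
        IsDirectedCycle (functionalGraph f) C L}.toFinset), eq_comm]
  · refine Finset.sum_const_nat fun C hC => ?_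
    rw [Set.mem_toFinset] at hC
    obtain ⟨⟨x, hx, hxC⟩, hcyc⟩ := hC
    obtain ⟨hL, c, hinj, hrange, -⟩ := id hcyc
    have : NeZero L := ⟨by omega⟩
    have hfib : (({x | x ∈ S ∧ minimalPeriod f x = L}.toFinset.filter fun y =>
        (functionalGraph f).toSimpleGraphInclusive.connectedComponentMk y = C : Finset V) : Set V)
        = C.supp := by
      ext y
      simp only [Finset.coe_filter, Set.mem_toFinset, Set.mem_ofPred_eq,
        SimpleGraph.ConnectedComponent.mem_supp_iff]
      refine ⟨fun h => h.2, fun h => ⟨?_, h⟩⟩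
      have hy : y ∈ S := functionalGraph_mem_of_reachable hS hx
        (SimpleGraph.ConnectedComponent.eq.1 (hxC.trans h.symm))
      exact ⟨hy, (isDirectedCycle_iff_minimalPeriod_eq hS hper hy).1 (h ▸ hcyc)⟩
    rw [← Set.ncard_coe_finset, hfib, ← hrange, ← Set.image_univ, Set.ncard_image_of_injective _ hinj,
      Set.ncard_univ, Nat.card_zmod]
  · intro x hx
    simp only [Set.coe_toFinset, Set.mem_ofPred_eq] at hx ⊢
    exact ⟨⟨x, hx.1, SimpleGraph.ConnectedComponent.connectedComponentMk_mem⟩,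
      (isDirectedCycle_iff_minimalPeriod_eq hS hper hx.1).2 hx.2⟩

/-! ### Counting fixed and periodic states -/

theorem card_filter_three_pow_dvd {e K : ℕ} (he : 1 ≤ e) (heK : e ≤ K) :
    ((Finset.range (3 ^ K)).filter fun y => 3 ^ e ∣ y * (1 + 2 * y)).card = 2 * 3 ^ (K - e) := by
  -- With 3^e = 2r+1, r represents -1/2, the root of 1+2y. For e ≥ 1 it is distinct from the root 0.
  obtain ⟨r, hr⟩ : Odd (3 ^ e) := Odd.pow (by decide)
  have hr0 : 0 < r := by
    have : 3 ^ 1 ≤ 3 ^ e := Nat.pow_le_pow_right (by norm_num) he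
    omega
  have hcount : ∀ v, ((Finset.range (3 ^ K)).filter (· ≡ v [MOD 3 ^ e])).card = 3 ^ (K - e) := by
    intro v
    rw [← Nat.count_eq_card_filter_range, Nat.count_modEq_card _ (by positivity),
      Nat.mod_eq_zero_of_dvd (pow_dvd_pow 3 heK), if_neg (Nat.not_lt_zero _), add_zero,
      Nat.pow_div heK (by norm_num)]
  have hiff : ∀ y, 3 ^ e ∣ y * (1 + 2 * y) ↔ y ≡ 0 [MOD 3 ^ e] ∨ y ≡ r [MOD 3 ^ e] := by
    intro y
    have hcop : Nat.Coprime y (1 + 2 * y) := by simp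
    have h2 : Nat.Coprime (3 ^ e) 2 := Nat.Coprime.pow_left _ (by decide)
    rw [hcop.isPrimePow_dvd_mul (Nat.prime_three.isPrimePow.pow (by omega)),
      Nat.modEq_zero_iff_dvd]
    refine or_congr_right ?_
    rw [← Nat.modEq_zero_iff_dvd]
    have h0 : 1 + 2 * r ≡ 0 [MOD 3 ^ e] := by
      rw [Nat.modEq_zero_iff_dvd, hr, add_comm]
    constructor
    · intro h
      exact Nat.ModEq.cancel_left_of_coprime h2 (Nat.ModEq.add_left_cancel' 1 (h.trans h0.symm))
    · intro h
      exact ((h.mul_left 2).add_left 1).trans h0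
  simp only [hiff]
  rw [Finset.filter_or, Finset.card_union_of_disjoint, hcount, hcount, two_mul]
  rw [Finset.disjoint_filter]
  intro y _ h1 h2
  have h3 := (h1.symm.trans h2).eq_of_lt_of_lt (by positivity) (by omega)
  omega

theorem castHom_mem_pmOneStates {k : ℕ} (hk : 1 ≤ k) (x : ZMod (3 ^ k)) :
    x ∈ pmOneStates k ↔
      ZMod.castHom (dvd_pow_self 3 (Nat.one_le_iff_ne_zero.1 hk)) (ZMod 3) x ≠ 0 := by
  have h : ZMod.castHom (dvd_pow_self 3 (Nat.one_le_iff_ne_zero.1 hk)) (ZMod 3) x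
      = ((x.val : ℤ) : ZMod 3) := by
    rw [ZMod.castHom_apply, Int.cast_natCast, ZMod.natCast_val]
  rw [h, pmOneStates, Ne, ZMod.intCast_zmod_eq_zero_iff_dvd]
  change (_ ∨ _) ↔ _
  simp only [Int.ModEq]
  omega

open Polynomial Polynomial.Chebyshev in
theorem eval_T_zmod_three {N : ℤ} (hN : Odd N) (x : ZMod 3) : (T (ZMod 3) N).eval x = x := by
  have hx : x = 0 ∨ x = 1 ∨ x = -1 := by revert x; decide
  rcases hx with rfl | rfl | rfl
  · exact T_eval_zero_of_odd _ hN
  · exact T_eval_one _ _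
  · rw [T_eval_neg_one, Int.negOnePow_odd _ hN]; simp

open Polynomial Polynomial.Chebyshev in
theorem eval_T_mem_pmOneStates {k : ℕ} (hk : 1 ≤ k) {N : ℤ} (hN : Odd N) (x : ZMod (3 ^ k)) :
    (T (ZMod (3 ^ k)) N).eval x ∈ pmOneStates k ↔ x ∈ pmOneStates k := by
  rw [castHom_mem_pmOneStates hk, castHom_mem_pmOneStates hk, ← Polynomial.eval_map_apply,
    map_T, eval_T_zmod_three hN]

open Polynomial Polynomial.Chebyshev in
theorem iterate_eval_T {R : Type*} [CommRing R] (n : ℤ) (i : ℕ) (x : R) :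
    (fun x => (T R n).eval x)^[i] x = (T R (n ^ i)).eval x := by
  induction i with
  | zero => simp
  | succ i ih => rw [Function.iterate_succ_apply', ih, pow_succ', T_mul, eval_comp]

open Polynomial Polynomial.Chebyshev in
theorem eval_T_intCast_eq_iff (M : ℕ) (N z : ℤ) :
    (T (ZMod M) N).eval (z : ZMod M) = z ↔ (M : ℤ) ∣ (T ℤ N).eval z - z := by
  have h := algebraMap_eval_T (R' := ZMod M) z N
  simp only [algebraMap_int_eq, eq_intCast] at h
  rw [← h, ← ZMod.intCast_zmod_eq_zero_iff_dvd, Int.cast_sub, sub_eq_zero]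

open Polynomial Polynomial.Chebyshev in
/-- The number of states `x ≡ ±1 (mod 3)` fixed by `T_N`, where `3^(s+1)` exactly divides
`N ^ 2 - 1`. -/
theorem ncard_fixed_eq {k s : ℕ} (hk : 1 ≤ k) {N c : ℤ} (hN : Odd N)
    (hs : N ^ 2 - 1 = 3 ^ (s + 1) * c) (hc : ¬ 3 ∣ c) :
    {x | x ∈ pmOneStates k ∧ (T (ZMod (3 ^ k)) N).eval x = x}.ncard =
      2 * ((Finset.range (3 ^ (k - 1))).filter
        fun y => 3 ^ (k - (s + 2)) ∣ y * (1 + 2 * y)).card := by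
  obtain ⟨k, rfl⟩ : ∃ k', k = k' + 1 := ⟨k - 1, by omega⟩
  rw [Nat.add_sub_cancel]
  set A := (Finset.range (3 ^ k)).filter fun y => 3 ^ (k + 1 - (s + 2)) ∣ y * (1 + 2 * y) with hA
  set g : ℕ → ZMod (3 ^ (k + 1)) := fun y => ((1 + 3 * y : ℕ) : ZMod (3 ^ (k + 1))) with hg
  set φ := ZMod.castHom (dvd_pow_self 3 (Nat.one_le_iff_ne_zero.1 hk)) (ZMod 3) with hφ
  have hφg : ∀ y, φ (g y) = 1 := by
    intro y
    have h3 : (3 : ZMod 3) = 0 := by decide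
    rw [hg, map_natCast]; push_cast; rw [h3]; simp
  have hfix : ∀ y, (T (ZMod (3 ^ (k + 1))) N).eval (g y) = g y ↔
      3 ^ (k + 1 - (s + 2)) ∣ y * (1 + 2 * y) := by
    intro y
    obtain ⟨d, hd, h⟩ := exists_eval_T_sub_eq hN hs hc y
    have hgy : g y = ((1 + 3 * y : ℤ) : ZMod (3 ^ (k + 1))) := by rw [hg]; push_cast; rfl
    have hcop : ∀ e, IsCoprime ((3 : ℤ) ^ e) d := fun e =>
      IsCoprime.pow_left ((Prime.coprime_iff_not_dvd Int.prime_three).2 hd)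
    rw [hgy, eval_T_intCast_eq_iff, h, ← Int.natCast_dvd_natCast]
    generalize he : k + 1 - (s + 2) = e
    push_cast
    constructor
    · intro h1
      have h1 := (hcop _).dvd_of_dvd_mul_right h1
      -- If k+1 ≤ s+2, truncated subtraction makes e = 0 and the divisibility is vacuous.
      rcases le_total (s + 2) (k + 1) with hle | hle
      · rw [show k + 1 = s + 2 + e by omega, pow_add] at h1
        simpa using (mul_dvd_mul_iff_left (by positivity)).1 h1
      · rw [show e = 0 by omega]; simp
    · intro h1
      refine Dvd.dvd.mul_right
        ((pow_dvd_pow 3 (by omega : k + 1 ≤ s + 2 + e)).trans ?_) _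
      rw [pow_add]
      exact mul_dvd_mul_left _ h1
  have hinj : Set.InjOn g A := by
    intro y hy z hz hyz
    have hlt : ∀ u ∈ A, 1 + 3 * u < 3 ^ (k + 1) := by
      intro u hu
      have := Finset.mem_range.1 (Finset.mem_filter.1 hu).1
      rw [pow_succ]; omega
    have := ((ZMod.natCast_eq_natCast_iff _ _ _).1 hyz).eq_of_lt_of_lt (hlt y hy) (hlt z hz)
    omega
  have hneg : ∀ x, (T (ZMod (3 ^ (k + 1))) N).eval (-x) = -x ↔
      (T (ZMod (3 ^ (k + 1))) N).eval x = x := by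
    intro x
    rw [T_eval_neg, Int.negOnePow_odd _ hN]
    simp
  have hex : ∀ x, φ x = 1 → ∃ y ∈ Finset.range (3 ^ k), g y = x := by
    intro x hx
    have hval : (x.val : ZMod 3) = (1 : ℕ) := by
      rw [ZMod.natCast_val, Nat.cast_one]; exact hx
    have hmod : x.val % 3 = 1 % 3 := (ZMod.natCast_eq_natCast_iff _ _ _).1 hval
    have hlt : x.val < 3 ^ k * 3 := x.val_lt.trans_eq (pow_succ 3 k)
    refine ⟨x.val / 3, Finset.mem_range.2 (by omega), ?_⟩
    rw [hg]
    dsimp only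
    rw [show 1 + 3 * (x.val / 3) = x.val by omega, ZMod.natCast_zmod_val]
  -- States 1 mod 3 are the g y; those -1 mod 3 are their negatives, fixed simultaneously because
  -- T_N is odd.
  have hset : {x | x ∈ pmOneStates (k + 1) ∧ (T (ZMod (3 ^ (k + 1))) N).eval x = x} =
      g '' A ∪ (fun y => -g y) '' A := by
    ext x
    constructor
    · rintro ⟨hx, hTx⟩
      rw [castHom_mem_pmOneStates hk] at hx
      have h3 : ∀ z : ZMod 3, z ≠ 0 → z = 1 ∨ z = -1 := by decide
      rcases h3 _ hx with h | h
      · obtain ⟨y, hy, rfl⟩ := hex x h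
        exact Or.inl ⟨y, Finset.mem_filter.2 ⟨hy, (hfix y).1 hTx⟩, rfl⟩
      · obtain ⟨y, hy, hyx⟩ := hex (-x) (by rw [map_neg, hφ, h, neg_neg])
        refine Or.inr ⟨y, Finset.mem_filter.2 ⟨hy, (hfix y).1 ?_⟩, by simp [hyx]⟩
        rw [hyx, hneg, hTx]
    · rintro (⟨y, hy, rfl⟩ | ⟨y, hy, rfl⟩)
      · refine ⟨?_, (hfix y).2 (Finset.mem_filter.1 hy).2⟩
        rw [castHom_mem_pmOneStates hk, ← hφ, hφg]; decide
      · refine ⟨?_, (hneg _).2 ((hfix y).2 (Finset.mem_filter.1 hy).2)⟩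
        rw [castHom_mem_pmOneStates hk, ← hφ, map_neg, hφg]; decide
  rw [hset, Set.ncard_union_eq, hinj.ncard_image,
    Set.InjOn.ncard_image (fun y hy z hz h => hinj hy hz (neg_injective h)),
    Set.ncard_coe_finset, two_mul]
  rw [Set.disjoint_left]
  rintro _ ⟨y, -, rfl⟩ ⟨z, -, hz⟩
  have h := congrArg φ hz
  dsimp only at h
  rw [map_neg, hφg, hφg] at h
  revert h; decide

/-- The number of states `x ≡ ±1 (mod 3)` whose period under `T_n` divides `3^j`. -/
theorem ncard_periodic_eq {n k : ℕ} (hn : 2 ≤ n) (hn6 : n % 6 = 1 ∨ n % 6 = 5) (hk : 1 ≤ k)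
    (j : ℕ) :
    {x | x ∈ pmOneStates k ∧ Function.IsPeriodicPt
      (fun x => (Polynomial.Chebyshev.T (ZMod (3 ^ k)) (n : ℤ)).eval x) (3 ^ j) x}.ncard =
      if k ≤ chebyshevW n + j + 1 then 2 * 3 ^ (k - 1) else 4 * 3 ^ (chebyshevW n + j) := by
  obtain ⟨hw, c, hc, hnc⟩ := exists_sq_sub_one_eq hn hn6
  obtain ⟨s, hs⟩ : ∃ s, chebyshevW n = s + 1 := ⟨chebyshevW n - 1, by omega⟩
  rw [hs] at hnc
  obtain ⟨d, hd, hnd⟩ := exists_pow_three_pow_sub_one_eq hnc hc j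
  have hodd : Odd (n : ℤ) := by
    rw [Int.odd_iff]; omega
  have h := ncard_fixed_eq (s := s + j) hk (N := (n : ℤ) ^ 3 ^ j) hodd.pow
    (by rw [← hnd, ← pow_mul, ← pow_mul, mul_comm]) hd
  simp only [Function.IsPeriodicPt, Function.IsFixedPt, iterate_eval_T]
  rw [h, hs]
  split_ifs with hle
  · rw [show k - (s + j + 2) = 0 by omega]
    simp
  · rw [card_filter_three_pow_dvd (by omega) (by omega),
      show k - 1 - (k - (s + j + 2)) = s + 1 + j by omega]
    ring

theorem ncard_pmOneStates {k : ℕ} (hk : 1 ≤ k) : (pmOneStates k).ncard = 2 * 3 ^ (k - 1) := by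
  have h : pmOneStates k = Set.range (Units.val : (ZMod (3 ^ k))ˣ → ZMod (3 ^ k)) := by
    ext x
    change _ ↔ IsUnit x
    rw [← ZMod.natCast_zmod_val x, ZMod.isUnit_iff_coprime, Nat.coprime_pow_right_iff hk,
      Nat.coprime_comm, Nat.prime_three.coprime_iff_not_dvd, ZMod.natCast_zmod_val]
    change (_ ∨ _) ↔ _
    simp only [Int.ModEq]
    omega
  rw [h, ← Set.image_univ, Set.ncard_image_of_injective _ Units.val_injective, Set.ncard_univ,
    Nat.card_eq_fintype_card, ZMod.card_units_eq_totient,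
    Nat.totient_prime_pow Nat.prime_three hk, mul_comm]

theorem ncard_minimalPeriod_eq_pow_succ_add {V : Type*} [Finite V] (f : V → V) (S : Set V)
    {p : ℕ} (hp : p.Prime) (i : ℕ) :
    {x | x ∈ S ∧ Function.minimalPeriod f x = p ^ (i + 1)}.ncard +
      {x | x ∈ S ∧ Function.IsPeriodicPt f (p ^ i) x}.ncard =
      {x | x ∈ S ∧ Function.IsPeriodicPt f (p ^ (i + 1)) x}.ncard := by
  simp only [Function.isPeriodicPt_iff_minimalPeriod_dvd]
  rw [← Set.ncard_union_eq]
  · congr 1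
    ext x
    constructor
    · rintro (⟨hx, h⟩ | ⟨hx, h⟩)
      · exact ⟨hx, h.dvd⟩
      · exact ⟨hx, h.trans (pow_dvd_pow p (Nat.le_succ i))⟩
    · rintro ⟨hx, h⟩
      by_cases hi : Function.minimalPeriod f x ∣ p ^ i
      · exact Or.inr ⟨hx, hi⟩
      · exact Or.inl ⟨hx, Nat.eq_prime_pow_of_dvd_least_prime_pow hp hi h⟩
  · rw [Set.disjoint_left]
    rintro x ⟨-, h⟩ ⟨-, h'⟩
    rw [h] at h'
    have := (Nat.pow_dvd_pow_iff_le_right hp.one_lt).1 h'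
    omega

/-! ### Assembling the cycle counts -/

theorem mainTheorem7 (n k : ℕ) (hn : 2 ≤ n) (hn6 : n % 6 = 1 ∨ n % 6 = 5) (hk : 1 ≤ k) :
    (∀ C ∈ pmOneComponents n k, C.supp ⊆ pmOneStates k) ∧
    (chebyshevW n + 2 ≤ k →
      (∀ i ∈ Finset.Icc 1 (k - chebyshevW n - 2),
        (pmOneCycles n k (3 ^ i)).ncard = 8 * 3 ^ (chebyshevW n - 1)) ∧
      (pmOneCycles n k 1).ncard = 4 * 3 ^ chebyshevW n ∧
      (pmOneCycles n k (3 ^ (k - chebyshevW n - 1))).ncard = 2 * 3 ^ (chebyshevW n - 1) ∧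
      (∀ C ∈ pmOneComponents n k,
        C ∈ pmOneCycles n k 1 ∨
        (∃ i ∈ Finset.Icc 1 (k - chebyshevW n - 2), C ∈ pmOneCycles n k (3 ^ i)) ∨
        C ∈ pmOneCycles n k (3 ^ (k - chebyshevW n - 1)))) ∧
    (k < chebyshevW n + 2 →
      (pmOneCycles n k 1).ncard = 2 * 3 ^ (k - 1) ∧
      ∀ C ∈ pmOneComponents n k, C ∈ pmOneCycles n k 1) := by
  obtain ⟨hw, -⟩ := exists_sq_sub_one_eq hn hn6
  have hodd : Odd (n : ℤ) := by rw [Int.odd_iff]; omega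
  set f : ZMod (3 ^ k) → ZMod (3 ^ k) :=
    fun x => (Polynomial.Chebyshev.T (ZMod (3 ^ k)) (n : ℤ)).eval x with hf
  set w := chebyshevW n with hwdef
  have hS : ∀ x, f x ∈ pmOneStates k ↔ x ∈ pmOneStates k := eval_T_mem_pmOneStates hk hodd
  have hF := ncard_periodic_eq hn hn6 hk
  -- For such j the count already equals the number of all states ±1 mod 3.
  have hall : ∀ j, k ≤ w + j + 1 → ∀ x ∈ pmOneStates k, Function.IsPeriodicPt f (3 ^ j) x := by
    intro j hj x hx
    have h : {x | x ∈ pmOneStates k ∧ Function.IsPeriodicPt f (3 ^ j) x} = pmOneStates k := by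
      refine Set.eq_of_subset_of_ncard_le (fun x hx => hx.1) ?_
      rw [hF j, if_pos hj, ncard_pmOneStates hk]
    rw [← h] at hx
    exact hx.2
  have hper : ∀ x ∈ pmOneStates k, x ∈ Function.periodicPts f := fun x hx =>
    ⟨3 ^ k, by positivity, hall k (by omega) x hx⟩
  have hcard : ∀ L, (pmOneCycles n k L).ncard * L =
      {x | x ∈ pmOneStates k ∧ Function.minimalPeriod f x = L}.ncard :=
    ncard_directedCycles_mul hS hper
  have hone : (pmOneCycles n k 1).ncard =
      if k ≤ w + 0 + 1 then 2 * 3 ^ (k - 1) else 4 * 3 ^ (w + 0) := by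
    rw [← hF 0, ← mul_one (Set.ncard _), hcard]
    simp only [Function.minimalPeriod_eq_one_iff_isFixedPt, pow_zero]
    rfl
  have hsucc : ∀ i, (pmOneCycles n k (3 ^ (i + 1))).ncard * 3 ^ (i + 1) +
      (if k ≤ w + i + 1 then 2 * 3 ^ (k - 1) else 4 * 3 ^ (w + i)) =
      if k ≤ w + (i + 1) + 1 then 2 * 3 ^ (k - 1) else 4 * 3 ^ (w + (i + 1)) := by
    intro i
    rw [hcard, ← hF, ← hF]
    exact ncard_minimalPeriod_eq_pow_succ_add f _ Nat.prime_three i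
  have hcycle : ∀ C ∈ pmOneComponents n k, ∃ i ≤ k - w - 1, C ∈ pmOneCycles n k (3 ^ i) := by
    rintro C ⟨x, hx, rfl⟩
    obtain ⟨i, hi, h⟩ := (Nat.dvd_prime_pow Nat.prime_three).1
      (hall (k - w - 1) (by omega) x hx).minimalPeriod_dvd
    exact ⟨i, hi, ⟨x, hx, rfl⟩, (isDirectedCycle_iff_minimalPeriod_eq hS hper hx).2 h⟩
  refine ⟨?_, fun hle => ⟨?_, ?_, ?_, ?_⟩, fun hlt => ⟨?_, ?_⟩⟩
  · rintro C ⟨x, hx, hxC⟩ y hy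
    exact functionalGraph_mem_of_reachable hS hx
      (SimpleGraph.ConnectedComponent.eq.1 (hxC.trans hy.symm))
  · intro i hi
    rw [Finset.mem_Icc] at hi
    obtain ⟨i, rfl⟩ : ∃ i', i = i' + 1 := ⟨i - 1, by omega⟩
    have h := hsucc i
    rw [if_neg (by omega), if_neg (by omega)] at h
    -- 4·3^(w+i+1) - 4·3^(w+i) = 8·3^(w-1)·3^(i+1).
    refine Nat.eq_of_mul_eq_mul_right (by positivity : 0 < 3 ^ (i + 1)) ?_
    obtain ⟨v, hv⟩ : ∃ v, w = v + 1 := ⟨w - 1, by omega⟩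
    rw [hv] at h ⊢
    rw [Nat.add_sub_cancel]
    refine Nat.add_right_cancel (h.trans ?_)
    ring
  · rw [hone, if_neg (by omega), add_zero]
  · obtain ⟨i, hi⟩ : ∃ i, k = w + i + 2 := ⟨k - w - 2, by omega⟩
    rw [show k - w - 1 = i + 1 by omega]
    have h := hsucc i
    rw [if_neg (by omega), if_pos (by omega)] at h
    -- At the last level k-1 = w+i+1, so 2·3^(k-1) - 4·3^(w+i) = 2·3^(w-1)·3^(i+1).
    refine Nat.eq_of_mul_eq_mul_right (by positivity : 0 < 3 ^ (i + 1)) ?_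
    obtain ⟨v, hv⟩ : ∃ v, w = v + 1 := ⟨w - 1, by omega⟩
    rw [show k - 1 = v + i + 2 by omega, hv] at h
    rw [hv, Nat.add_sub_cancel]
    refine Nat.add_right_cancel (h.trans ?_)
    ring
  · intro C hC
    obtain ⟨i, hi, h⟩ := hcycle C hC
    rcases Nat.eq_zero_or_pos i with rfl | hpos
    · exact Or.inl h
    · rcases hi.eq_or_lt with rfl | hlt
      · exact Or.inr (Or.inr h)
      · exact Or.inr (Or.inl ⟨i, Finset.mem_Icc.2 ⟨hpos, by omega⟩, h⟩)
  · rw [hone, if_pos (by omega)]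
  · intro C hC
    obtain ⟨i, hi, h⟩ := hcycle C hC
    rw [show i = 0 by omega] at h
    exact h
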